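/- Let $\mathbb{F}$ be a division ring, $\sigma:\mathbb{F}\to\mathbb{F}$ a ring endomorphism and $\delta:\mathbb{F}\to\mathbb{F}$ a $\sigma$-derivation, i.e. an additive map with $\delta(ab)=\sigma(a)\delta(b)+\delta(a)b$. Let $\mathbb{F}[x;\sigma,\delta]$ be the skew polynomial ring: the left $\mathbb{F}$-vector space with basis $1,x,x^2,\ldots$, with the ring structure determined by $xa=\sigma(a)x+\delta(a)$ for $a\in\mathbb{F}$. Call $b\in\mathbb{F}$ a $(\sigma,\delta)$-conjugate of $a\in\mathbb{F}$ if $b=\sigma(\beta)a\beta^{-1}+\delta(\beta)\beta^{-1}$ for some $\beta\in\mathbb{F}\setminus\{0\}$. We say that $P$ divides $F$ on the right if $F=GP$ for some $G\in\mathbb{F}[x;\sigma,\delta]$, and that $a$ is a zero of $F$ of multiplicity $r\geq 1$ if $(x-a)^r$ divides $F$ on the right. The least left common multiple of $P_1,\ldots,P_n$ is the monic skew polynomial $M$ that is divisible on the right by every $P_i$ and that divides on the right every skew polynomial divisible on the right by all the $P_i$. Let $a_1,\ldots,a_n\in\mathbb{F}$ be pairwise non-conjugate, let $r_1,\ldots,r_n$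 be positive integers, and let $F\in\mathbb{F}[x;\sigma,\delta]$, $F\neq 0$, have $a_i$ as a zero of multiplicity $r_i$ for $i=1,\ldots,n$. Then $$\sum_{i=1}^n r_i\leq\deg(F).$$ Furthermore, the least left common multiple $M$ of $(x-a_1)^{r_1},\ldots,(x-a_n)^{r_n}$ exists and is unique, and equality holds if and only if $F=cM$ for some $c\in\mathbb{F}\setminus\{0\}$. -/

import Mathlib

/-- A `σ`-derivation of a division ring `K`: an additive map `δ` with
`δ (a * b) = σ a * δ b + δ a * b`. -/
structure SkewDerivation {K : Type*} [DivisionRing K] (σ : K →+* K) extends AddMonoidHom K K where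
  leibniz' : ∀ a b : K, toFun (a * b) = σ a * toFun b + toFun a * b

namespace SkewDerivation

instance {K : Type*} [DivisionRing K] (σ : K →+* K) : CoeFun (SkewDerivation σ) (fun _ => K → K) :=
  ⟨fun δ => δ.toAddMonoidHom⟩

theorem leibniz {K : Type*} [DivisionRing K] {σ : K →+* K} (δ : SkewDerivation σ) (a b : K) :
    δ (a * b) = σ a * δ b + δ a * b := δ.leibniz' a b

end SkewDerivation

/-- The underlying left `K`-vector space of the skew polynomial ring `K[x; σ, δ]`: finitely
supported coefficient families, `f` standing for `∑ i, f i x ^ i`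
(coefficients written on the left). -/
def OrePoly {K : Type*} [DivisionRing K] (σ : K →+* K) (_δ : SkewDerivation σ) : Type _ :=
  ℕ →₀ K

namespace OrePoly

noncomputable section

variable {K : Type*} [DivisionRing K] {σ : K →+* K} {δ : SkewDerivation σ}

instance : AddCommGroup (OrePoly σ δ) := inferInstanceAs (AddCommGroup (ℕ →₀ K))

/-- The coefficient family of a skew polynomial. -/
def toFinsupp (F : OrePoly σ δ) : ℕ →₀ K := F

/-- The coefficient of `x ^ i`. -/
def coeff (F : OrePoly σ δ) (i : ℕ) : K := F.toFinsupp i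

/-- The monomial `a x ^ i`. -/
def monomial (i : ℕ) (a : K) : OrePoly σ δ := (Finsupp.single i a : ℕ →₀ K)

theorem endo_mul_apply (f g : AddMonoid.End (ℕ →₀ K)) (h : ℕ →₀ K) : (f * g) h = f (g h) := rfl

theorem endo_add_apply (f g : AddMonoid.End (ℕ →₀ K)) (h : ℕ →₀ K) : (f + g) h = f h + g h := rfl

/-- Left multiplication by `x`, as forced by `x a = σ(a) x + δ(a)`:
`a x ^ i ↦ σ(a) x ^ (i + 1) + δ(a) x ^ i`. -/
def xOp (σ : K →+* K) (δ : SkewDerivation σ) : AddMonoid.End (ℕ →₀ K) :=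
  Finsupp.liftAddHom fun i =>
    (Finsupp.singleAddHom (i + 1)).comp (σ : K →+ K) + (Finsupp.singleAddHom i).comp δ.toAddMonoidHom

/-- Left multiplication by `∑ i, f i x ^ i`. -/
def mulOp (σ : K →+* K) (δ : SkewDerivation σ) : (ℕ →₀ K) →+ AddMonoid.End (ℕ →₀ K) :=
  Finsupp.liftAddHom fun i =>
    (AddMonoidHom.mulRight (xOp σ δ ^ i)).comp
      ((Module.toAddMonoidEnd K (ℕ →₀ K) : K →+* AddMonoid.End (ℕ →₀ K)) :
        K →+ AddMonoid.End (ℕ →₀ K))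

theorem xOp_single (i : ℕ) (a : K) :
    xOp σ δ (Finsupp.single i a) = Finsupp.single (i + 1) (σ a) + Finsupp.single i (δ a) := by
  exact Finsupp.liftAddHom_apply_single
    (fun i => (Finsupp.singleAddHom (i + 1)).comp (σ : K →+ K) +
      (Finsupp.singleAddHom i).comp δ.toAddMonoidHom) i a

theorem mulOp_single_apply (i : ℕ) (a : K) (g : ℕ →₀ K) :
    mulOp σ δ (Finsupp.single i a) g = a • (xOp σ δ ^ i) g := by
  rw [mulOp, Finsupp.liftAddHom_apply_single]
  rfl

theorem xOp_smul (a : K) (g : ℕ →₀ K) :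
    xOp σ δ (a • g) = σ a • xOp σ δ g + δ a • g := by
  induction g using Finsupp.induction_linear with
  | zero => simp
  | add f g hf hg => rw [smul_add, map_add, map_add, hf, hg, smul_add, smul_add]; abel
  | single i b =>
    simp only [Finsupp.smul_single, smul_eq_mul, xOp_single, SkewDerivation.leibniz, map_mul,
      smul_add, Finsupp.single_add]
    abel

theorem xOp_pow_single_zero_one (i : ℕ) :
    (xOp σ δ ^ i) (Finsupp.single 0 1) = Finsupp.single i 1 := by
  have h1 : δ 1 = 0 := by
    have h := δ.leibniz 1 1
    simpa using h
  induction i with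
  | zero => simp
  | succ i ih => rw [pow_succ', endo_mul_apply, ih, xOp_single, h1]; simp

theorem mulOp_smul (a : K) (f g : ℕ →₀ K) : mulOp σ δ (a • f) g = a • mulOp σ δ f g := by
  induction f using Finsupp.induction_linear with
  | zero => simp
  | add f f' hf hf' => simp only [smul_add, map_add, endo_add_apply, hf, hf']
  | single i b => simp only [Finsupp.smul_single, smul_eq_mul, mulOp_single_apply, mul_smul]

theorem mulOp_xOp (f g : ℕ →₀ K) : mulOp σ δ (xOp σ δ f) g = xOp σ δ (mulOp σ δ f g) := by
  induction f using Finsupp.induction_linear with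
  | zero => simp
  | add f f' hf hf' => simp only [map_add, endo_add_apply, hf, hf']
  | single i b =>
    simp only [xOp_single, map_add, endo_add_apply, mulOp_single_apply, xOp_smul, pow_succ',
      endo_mul_apply]

theorem mulOp_mulOp (f g h : ℕ →₀ K) :
    mulOp σ δ (mulOp σ δ f g) h = mulOp σ δ f (mulOp σ δ g h) := by
  have hpow : ∀ (i : ℕ) (g : ℕ →₀ K),
      mulOp σ δ ((xOp σ δ ^ i) g) h = (xOp σ δ ^ i) (mulOp σ δ g h) := by
    intro i
    induction i with
    | zero => intro g; simp
    | succ i ih => intro g; simp only [pow_succ', endo_mul_apply, mulOp_xOp, ih]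
  induction f using Finsupp.induction_linear with
  | zero => simp
  | add f f' hf hf' => simp only [map_add, endo_add_apply, hf, hf']
  | single i b => simp only [mulOp_single_apply, mulOp_smul, hpow]

theorem mulOp_one_left (g : ℕ →₀ K) : mulOp σ δ (Finsupp.single 0 1) g = g := by
  simp [mulOp_single_apply]

theorem mulOp_one_right (f : ℕ →₀ K) : mulOp σ δ f (Finsupp.single 0 1) = f := by
  induction f using Finsupp.induction_linear with
  | zero => simp
  | add f f' hf hf' => simp only [map_add, endo_add_apply, hf, hf']
  | single i b => rw [mulOp_single_apply, xOp_pow_single_zero_one]; simp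

/-- The skew polynomial ring `K[x; σ, δ]`. -/
instance : Ring (OrePoly σ δ) :=
  { (inferInstance : AddCommGroup (OrePoly σ δ)) with
    mul := fun f g => mulOp σ δ f g
    one := (Finsupp.single 0 1 : ℕ →₀ K)
    left_distrib := fun f g h => map_add (mulOp σ δ f) g h
    right_distrib := fun f g h => congrArg (fun e : AddMonoid.End (ℕ →₀ K) => e h)
      (map_add (mulOp σ δ) f g)
    zero_mul := fun f => congrArg (fun e : AddMonoid.End (ℕ →₀ K) => e f) (map_zero (mulOp σ δ))
    mul_zero := fun f => map_zero (mulOp σ δ f)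
    mul_assoc := mulOp_mulOp
    one_mul := mulOp_one_left
    mul_one := mulOp_one_right }

/-- The inclusion of `K` in `K[x; σ, δ]` as the subring of constants. -/
def C : K →+* OrePoly σ δ where
  toFun a := monomial 0 a
  map_one' := rfl
  map_zero' := Finsupp.single_zero 0
  map_add' := Finsupp.single_add 0
  map_mul' a b := by
    change (Finsupp.single 0 (a * b) : ℕ →₀ K) = mulOp σ δ (Finsupp.single 0 a) (Finsupp.single 0 b)
    simp [mulOp_single_apply]

/-- The indeterminate `x`. -/
def X : OrePoly σ δ := monomial 1 1

theorem X_mul_C (a : K) : (X * C a : OrePoly σ δ) = C (σ a) * X + C (δ a) := by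
  change mulOp σ δ (Finsupp.single 1 1) (Finsupp.single 0 a) =
    mulOp σ δ (Finsupp.single 0 (σ a)) (Finsupp.single 1 1) + (Finsupp.single 0 (δ a) : ℕ →₀ K)
  simp [mulOp_single_apply, xOp_single]

theorem C_mul_X_pow (a : K) (i : ℕ) : (C a * X ^ i : OrePoly σ δ) = monomial i a := by
  have hX : ∀ j : ℕ, (X ^ j : OrePoly σ δ) = monomial j 1 := by
    intro j
    induction j with
    | zero => rfl
    | succ j ih =>
      rw [pow_succ', ih]
      change mulOp σ δ (Finsupp.single 1 1) (Finsupp.single j 1) = Finsupp.single (j + 1) 1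
      rw [mulOp_single_apply, ← xOp_pow_single_zero_one (σ := σ) (δ := δ) j, one_smul, pow_one,
        ← endo_mul_apply, ← pow_succ', xOp_pow_single_zero_one]
  rw [hX]
  change mulOp σ δ (Finsupp.single 0 a) (Finsupp.single i 1) = Finsupp.single i a
  simp [mulOp_single_apply]

/-- The degree: the largest `i` with `coeff F i ≠ 0`, and `⊥` if `F = 0`. -/
def degree (F : OrePoly σ δ) : WithBot ℕ := F.toFinsupp.support.max

/-- Leading coefficient one (in particular `F ≠ 0`). -/
def Monic (F : OrePoly σ δ) : Prop := ∃ d : ℕ, F.degree = d ∧ F.coeff d = 1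

/-- `P` divides `F` on the right: `F = G P` for some `G`. -/
def RightDvd (P F : OrePoly σ δ) : Prop := ∃ G : OrePoly σ δ, F = G * P

/-- `a` is a zero of `F` of multiplicity `r`: `(x - a) ^ r` divides `F` on the right. -/
def IsZeroOfMult (F : OrePoly σ δ) (a : K) (r : ℕ) : Prop := RightDvd ((X - C a) ^ r) F

/-- `M` is the (monic) least left common multiple of the `P i`: a left multiple of every `P i` such
that every left multiple of all the `P i` is a left multiple of `M`. -/
def IsLCLM {ι : Type*} (P : ι → OrePoly σ δ) (M : OrePoly σ δ) : Prop :=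
  M.Monic ∧ (∀ i, RightDvd (P i) M) ∧ ∀ G : OrePoly σ δ, (∀ i, RightDvd (P i) G) → RightDvd M G

end

end OrePoly

/-- `b` is a `(σ, δ)`-conjugate of `a`: `b = σ(β) a β⁻¹ + δ(β) β⁻¹` for some `β ≠ 0`. -/
def SkewConj {K : Type*} [DivisionRing K] (σ : K →+* K) (δ : SkewDerivation σ) (a b : K) : Prop :=
  ∃ β : K, β ≠ 0 ∧ b = σ β * a * β⁻¹ + δ β * β⁻¹

/-! Write `R` for the skew polynomial ring; `Ideal` means left ideal, and right divisibility by `P`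
is membership in `R P`. Right division makes left ideals principal and gives `R / R M` left
`K`-dimension `deg M`. Hence the intersection of the `R (x - a_i) ^ r_i` is `R M` with `M` the least
left common multiple, and everything reduces to `deg M = ∑ r_i`. This holds by the Chinese remainder
theorem (`finrank_quotient_inf`) once each ideal is comaximal with the intersection of the previous
ones. If not, both lie in a maximal left ideal `m`, and the simple module `R / m` has nonzero
vectors killed by `x - a_i` and by `x - a_j` with `i ≠ j`; `skewConj_of_linear_annihilators` then
makes `a_i` and `a_j` conjugate. -/

namespace OrePoly

noncomputable section

variable {K : Type*} [DivisionRing K] {σ : K →+* K} {δ : SkewDerivation σ}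

/-! ### Coefficients and degrees -/

@[ext] theorem ext_coeff {F G : OrePoly σ δ} (h : ∀ i, F.coeff i = G.coeff i) : F = G :=
  Finsupp.ext h

@[simp] theorem coeff_zero (i : ℕ) : (0 : OrePoly σ δ).coeff i = 0 := rfl

@[simp] theorem coeff_add (F G : OrePoly σ δ) (i : ℕ) :
    (F + G).coeff i = F.coeff i + G.coeff i := rfl

@[simp] theorem coeff_neg (F : OrePoly σ δ) (i : ℕ) : (-F).coeff i = -F.coeff i := rfl

@[simp] theorem coeff_sub (F G : OrePoly σ δ) (i : ℕ) :
    (F - G).coeff i = F.coeff i - G.coeff i := by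
  rw [sub_eq_add_neg, coeff_add, coeff_neg, sub_eq_add_neg]

theorem coeff_monomial (i j : ℕ) (a : K) :
    (monomial i a : OrePoly σ δ).coeff j = if i = j then a else 0 :=
  Finsupp.single_apply

theorem coeff_C (a : K) (j : ℕ) : (C a : OrePoly σ δ).coeff j = if 0 = j then a else 0 :=
  coeff_monomial 0 j a

@[simp] theorem coeff_C_mul (a : K) (G : OrePoly σ δ) (i : ℕ) :
    (C a * G).coeff i = a * G.coeff i := by
  change (mulOp σ δ (Finsupp.single 0 a) G.toFinsupp) i = _
  rw [mulOp_single_apply]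
  rfl

theorem coeff_X_mul (G : OrePoly σ δ) :
    (X * G).coeff 0 = δ (G.coeff 0) ∧
      ∀ k, (X * G).coeff (k + 1) = σ (G.coeff k) + δ (G.coeff (k + 1)) := by
  have h : (X * G : OrePoly σ δ) = xOp σ δ G.toFinsupp := by
    change mulOp σ δ (Finsupp.single 1 1) G.toFinsupp = _
    rw [mulOp_single_apply, pow_one, one_smul]
  suffices ∀ g : ℕ →₀ K, (xOp σ δ g) 0 = δ (g 0) ∧
      ∀ k, (xOp σ δ g) (k + 1) = σ (g k) + δ (g (k + 1)) by
    rw [h]; exact this G.toFinsupp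
  intro g
  induction g using Finsupp.induction_linear with
  | zero => simp
  | add f g hf hg =>
    refine ⟨by simp [hf.1, hg.1], fun k => ?_⟩
    simp only [map_add, Finsupp.add_apply, hf.2, hg.2]
    abel
  | single i b =>
    refine ⟨?_, fun k => ?_⟩
    · by_cases hi : i = 0 <;> simp [xOp_single, hi]
    · by_cases hi : i = k
      · subst hi; simp [xOp_single]
      · by_cases hi' : i = k + 1 <;> simp [xOp_single, hi, hi']

/-- All coefficients from `x ^ d` on vanish. -/
def DegLT (F : OrePoly σ δ) (d : ℕ) : Prop := ∀ k, d ≤ k → F.coeff k = 0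

theorem DegLT.mono {F : OrePoly σ δ} {d e : ℕ} (h : F.DegLT d) (hde : d ≤ e) : F.DegLT e :=
  fun k hk => h k (hde.trans hk)

theorem DegLT.add {F G : OrePoly σ δ} {d : ℕ} (hF : F.DegLT d) (hG : G.DegLT d) :
    (F + G).DegLT d := fun k hk => by simp [hF k hk, hG k hk]

theorem DegLT.eq_zero {F : OrePoly σ δ} (hF : F.DegLT 0) : F = 0 :=
  ext_coeff fun i => hF i (Nat.zero_le i)

theorem exists_degLT (F : OrePoly σ δ) : ∃ d, F.DegLT d := by
  refine ⟨F.toFinsupp.support.sup id + 1, fun k hk => ?_⟩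
  by_contra h
  have : k ≤ F.toFinsupp.support.sup id :=
    Finset.le_sup (f := id) (Finsupp.mem_support_iff.2 h)
  omega

theorem DegLT.C_mul {F : OrePoly σ δ} {d : ℕ} (hF : F.DegLT d) (a : K) : (C a * F).DegLT d :=
  fun k hk => by simp [hF k hk]

theorem DegLT.X_pow_mul {G : OrePoly σ δ} {n : ℕ} (hG : G.DegLT (n + 1)) (m : ℕ) :
    (X ^ m * G).DegLT (m + n + 1) ∧ (X ^ m * G).coeff (m + n) = σ^[m] (G.coeff n) := by
  induction m with
  | zero => simpa using hG
  | succ m ih =>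
    rw [pow_succ', mul_assoc]
    refine ⟨fun k hk => ?_, ?_⟩
    · obtain ⟨k, rfl⟩ : ∃ j, k = j + 1 := ⟨k - 1, by omega⟩
      rw [(coeff_X_mul _).2, ih.1 k (by omega), ih.1 (k + 1) (by omega)]
      simp
    · rw [show m + 1 + n = m + n + 1 by omega, (coeff_X_mul _).2, ih.2, ih.1 _ le_rfl,
        Function.iterate_succ_apply']
      simp

theorem DegLT.sub_monomial {F : OrePoly σ δ} {m : ℕ} (hF : F.DegLT (m + 1)) :
    (F - C (F.coeff m) * X ^ m).DegLT m := by
  intro k hk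
  rw [C_mul_X_pow, coeff_sub, coeff_monomial]
  split_ifs with h
  · rw [h, sub_self]
  · rw [hF k (by omega), sub_zero]

theorem DegLT.mul {F G : OrePoly σ δ} {m n : ℕ} (hF : F.DegLT (m + 1)) (hG : G.DegLT (n + 1)) :
    (F * G).DegLT (m + n + 1) ∧ (F * G).coeff (m + n) = F.coeff m * σ^[m] (G.coeff n) := by
  have key : ∀ F' : OrePoly σ δ, (F' * G).DegLT (m + n) → ∀ a : K,
      ((C a * X ^ m + F') * G).DegLT (m + n + 1) ∧
      ((C a * X ^ m + F') * G).coeff (m + n) = a * σ^[m] (G.coeff n) := by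
    intro F' h a
    have hX := hG.X_pow_mul m
    rw [add_mul, mul_assoc]
    refine ⟨(hX.1.C_mul a).add (h.mono (by omega)), ?_⟩
    rw [coeff_add, h _ le_rfl, coeff_C_mul, hX.2, add_zero]
  have hsplit : F = C (F.coeff m) * X ^ m + (F - C (F.coeff m) * X ^ m) := by abel
  have hF' := hF.sub_monomial
  -- The part of `F` below `x ^ m` cannot reach degree `m + n`, so only the leading terms contribute
  -- there.
  have hF'' : ((F - C (F.coeff m) * X ^ m) * G).DegLT (m + n) := by
    clear hsplit key
    generalize F - C (F.coeff m) * X ^ m = H at hF'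
    clear hF
    induction m generalizing H with
    | zero => rw [hF'.eq_zero, zero_mul]; exact fun _ _ => rfl
    | succ m ih =>
      have h := ih _ hF'.sub_monomial
      have : H = C (H.coeff m) * X ^ m + (H - C (H.coeff m) * X ^ m) := by abel
      rw [this, add_mul, mul_assoc, show m + 1 + n = m + n + 1 by omega]
      exact ((hG.X_pow_mul m).1.C_mul _).add (h.mono (by omega))
  have := key _ hF'' (F.coeff m)
  rwa [← hsplit] at this

theorem degree_eq_iff {F : OrePoly σ δ} {d : ℕ} :
    F.degree = d ↔ F.DegLT (d + 1) ∧ F.coeff d ≠ 0 := by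
  constructor
  · intro h
    refine ⟨fun k hk => ?_, Finsupp.mem_support_iff.1 (Finset.mem_of_max h)⟩
    by_contra hne
    exact absurd (Finset.le_max_of_eq (Finsupp.mem_support_iff.2 hne) h) (not_le.2 hk)
  · rintro ⟨h, hne⟩
    apply le_antisymm
    · refine Finset.max_le fun k hk => ?_
      rw [Nat.cast_withBot, WithBot.coe_le_coe]
      by_contra hlt
      exact Finsupp.mem_support_iff.1 hk (h k (by omega))
    · exact Finset.le_max (Finsupp.mem_support_iff.2 hne)

theorem exists_degree_eq {F : OrePoly σ δ} (hF : F ≠ 0) : ∃ d : ℕ, F.degree = d := by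
  obtain ⟨d, hd⟩ := Finset.max_of_nonempty (s := F.toFinsupp.support)
    (Finsupp.support_nonempty_iff.2 hF)
  exact ⟨d, hd⟩

/-- No cancellation: a ring endomorphism of a division ring is injective, so `σ^[m]` keeps the
leading coefficient of `G` nonzero. -/
theorem degree_mul {F G : OrePoly σ δ} {m n : ℕ} (hF : F.degree = m) (hG : G.degree = n) :
    (F * G).degree = (m + n : ℕ) := by
  rw [degree_eq_iff] at *
  have h := hF.1.mul hG.1
  refine ⟨h.1, ?_⟩
  rw [h.2]
  refine mul_ne_zero hF.2 ?_
  rw [← RingHom.coe_pow]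
  exact (map_ne_zero _).2 hG.2

theorem monic_iff {F : OrePoly σ δ} : F.Monic ↔ ∃ d, F.DegLT (d + 1) ∧ F.coeff d = 1 := by
  simp only [Monic, degree_eq_iff]
  exact ⟨fun ⟨d, h, h1⟩ => ⟨d, h.1, h1⟩, fun ⟨d, h, h1⟩ => ⟨d, ⟨h, by simp [h1]⟩, h1⟩⟩

theorem degLT_X_sub_C (a : K) : (X - C a : OrePoly σ δ).DegLT 2 := fun k hk => by
  rw [coeff_sub, coeff_C, X, coeff_monomial, if_neg (by omega), if_neg (by omega), sub_zero]

theorem X_sub_C_pow (a : K) (r : ℕ) :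
    ((X - C a) ^ r : OrePoly σ δ).DegLT (r + 1) ∧ ((X - C a) ^ r : OrePoly σ δ).coeff r = 1 := by
  induction r with
  | zero =>
    rw [pow_zero, ← map_one C]
    exact ⟨fun k hk => by rw [coeff_C, if_neg (by omega)], by rw [coeff_C, if_pos rfl]⟩
  | succ r ih =>
    have h := ih.1.mul (degLT_X_sub_C a)
    refine ⟨h.1, ?_⟩
    rw [pow_succ, h.2, ih.2, coeff_sub, coeff_C, X, coeff_monomial]
    simp

/-! ### Right division and principal left ideals -/

/-- `c x ^ e P` has leading coefficient `c σ^e(1) = c`, so any leading term can be cancelled even if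
`σ` is not surjective. -/
theorem exists_sub_mul_degLT {P : OrePoly σ δ} {d : ℕ} (hP : P.DegLT (d + 1))
    (h1 : P.coeff d = 1) (F : OrePoly σ δ) : ∃ Q, (F - Q * P).DegLT d := by
  obtain ⟨N, hN⟩ := F.exists_degLT
  induction N generalizing F with
  | zero => exact ⟨0, by rw [zero_mul, sub_zero]; exact hN.mono (Nat.zero_le d)⟩
  | succ N ih =>
    by_cases hd : N < d
    · exact ⟨0, by rw [zero_mul, sub_zero]; exact hN.mono hd⟩
    obtain ⟨e, rfl⟩ : ∃ e, N = e + d := ⟨N - d, by omega⟩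
    have hX := hP.X_pow_mul e
    obtain ⟨Q, hQ⟩ := ih (F - C (F.coeff (e + d)) * (X ^ e * P)) (by
      intro k hk
      rw [coeff_sub, coeff_C_mul]
      rcases hk.eq_or_lt with rfl | hk
      · rw [hX.2, h1, ← RingHom.coe_pow, map_one, mul_one, sub_self]
      · rw [hN k hk, hX.1 k hk, mul_zero, sub_zero])
    refine ⟨C (F.coeff (e + d)) * X ^ e + Q, ?_⟩
    rwa [add_mul, mul_assoc, ← sub_sub]

theorem eq_zero_of_degLT_of_eq_mul {P G : OrePoly σ δ} {d : ℕ} (hP : P.DegLT (d + 1))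
    (h1 : P.coeff d = 1) (h : (G * P).DegLT d) : G = 0 := by
  by_contra hG
  obtain ⟨e, he⟩ := exists_degree_eq hG
  have := degree_eq_iff.1 (degree_mul he (degree_eq_iff.2 ⟨hP, by simp [h1]⟩))
  exact this.2 (h _ (by omega))

theorem exists_span_singleton {J : Ideal (OrePoly σ δ)} {F : OrePoly σ δ} (hFJ : F ∈ J)
    (hF : F ≠ 0) : ∃ M : OrePoly σ δ, M.Monic ∧ J = Ideal.span {M} := by
  classical
  have hex : ∃ d, ∃ M ∈ J, M.DegLT (d + 1) ∧ M.coeff d = 1 := by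
    obtain ⟨d, hd⟩ := exists_degree_eq hF
    rw [degree_eq_iff] at hd
    exact ⟨d, C (F.coeff d)⁻¹ * F, J.mul_mem_left _ hFJ, hd.1.C_mul _, by
      rw [coeff_C_mul, inv_mul_cancel₀ hd.2]⟩
  obtain ⟨M, hMJ, hM, h1⟩ := Nat.find_spec hex
  refine ⟨M, monic_iff.2 ⟨_, hM, h1⟩, le_antisymm (fun G hG => ?_)
    ((Ideal.span_singleton_le_iff_mem _).2 hMJ)⟩
  obtain ⟨Q, hQ⟩ := exists_sub_mul_degLT hM h1 G
  rw [Ideal.mem_span_singleton']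
  refine ⟨Q, ?_⟩
  by_contra hne
  obtain ⟨e, he⟩ := exists_degree_eq (sub_ne_zero.2 (Ne.symm hne))
  rw [degree_eq_iff] at he
  refine Nat.find_min hex (m := e) ?_ ⟨C ((G - Q * M).coeff e)⁻¹ * (G - Q * M),
    J.mul_mem_left _ (J.sub_mem hG (J.mul_mem_left _ hMJ)), he.1.C_mul _, by
      rw [coeff_C_mul, inv_mul_cancel₀ he.2]⟩
  by_contra hlt
  exact he.2 (hQ e (by omega))

theorem rightDvd_iff {P F : OrePoly σ δ} : RightDvd P F ↔ F ∈ Ideal.span {P} := by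
  rw [Ideal.mem_span_singleton']
  exact ⟨fun ⟨G, h⟩ => ⟨G, h.symm⟩, fun ⟨G, h⟩ => ⟨G, h.symm⟩⟩

/-! ### Dimensions of quotients over `K` -/

instance : Module K (OrePoly σ δ) := Module.compHom _ (C : K →+* OrePoly σ δ)

theorem smul_eq_C_mul (a : K) (F : OrePoly σ δ) : a • F = C a * F := rfl

instance : IsScalarTower K (OrePoly σ δ) (OrePoly σ δ) :=
  ⟨fun a F G => mul_assoc (C a) F G⟩

theorem coeff_sum {ι : Type*} (s : Finset ι) (f : ι → OrePoly σ δ) (i : ℕ) :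
    (∑ j ∈ s, f j).coeff i = ∑ j ∈ s, (f j).coeff i :=
  map_sum (⟨⟨fun F => F.coeff i, coeff_zero i⟩, fun F G => coeff_add F G i⟩ : OrePoly σ δ →+ K) f s

theorem coeff_linearCombination (d : ℕ) (c : Fin d → K) (k : ℕ) :
    (Fintype.linearCombination K (fun i : Fin d => (X ^ (i : ℕ) : OrePoly σ δ)) c).coeff k =
      if h : k < d then c ⟨k, h⟩ else 0 := by
  simp only [Fintype.linearCombination_apply, coeff_sum, smul_eq_C_mul, C_mul_X_pow,
    coeff_monomial]
  split_ifs with h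
  · rw [Finset.sum_eq_single ⟨k, h⟩]
    · simp
    · intro b _ hb
      exact if_neg fun hbk => hb (Fin.ext hbk)
    · simp
  · exact Finset.sum_eq_zero fun b _ => if_neg (by omega)

/-- Remainders of right division are unique representatives, so the classes of `1, x, …, x ^ (d -
1)` form a basis. -/
theorem finrank_quotient_span {M : OrePoly σ δ} {d : ℕ} (hM : M.DegLT (d + 1))
    (h1 : M.coeff d = 1) :
    Module.Finite K (OrePoly σ δ ⧸ Ideal.span {M}) ∧
      Module.finrank K (OrePoly σ δ ⧸ Ideal.span {M}) = d := by
  let φ := Fintype.linearCombination K (fun i : Fin d => (X ^ (i : ℕ) : OrePoly σ δ))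
  let ψ : (Fin d → K) →ₗ[K] (OrePoly σ δ ⧸ Ideal.span {M}) :=
    ((Submodule.mkQ (Ideal.span {M})).restrictScalars K).comp φ
  have hφ : ∀ c, (φ c).DegLT d := fun c k hk => by
    rw [coeff_linearCombination, dif_neg (by omega)]
  have hinj : Function.Injective ψ := by
    rw [injective_iff_map_eq_zero]
    intro c hc
    have hc' : φ c ∈ Ideal.span {M} := (Submodule.Quotient.mk_eq_zero _).1 hc
    obtain ⟨G, hG⟩ := Ideal.mem_span_singleton'.1 hc'
    have hG0 := eq_zero_of_degLT_of_eq_mul hM h1 (hG ▸ hφ c)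
    rw [hG0, zero_mul] at hG
    ext i
    have := coeff_linearCombination (σ := σ) (δ := δ) d c i
    rw [dif_pos i.2] at this
    rw [← this]
    change (φ c).coeff i = 0
    rw [← hG, coeff_zero]
  have hsurj : Function.Surjective ψ := by
    intro q
    obtain ⟨F, rfl⟩ := Submodule.Quotient.mk_surjective _ q
    obtain ⟨Q, hQ⟩ := exists_sub_mul_degLT hM h1 F
    refine ⟨fun i => (F - Q * M).coeff i, ?_⟩
    have : φ (fun i => (F - Q * M).coeff i) = F - Q * M := by
      ext k
      rw [coeff_linearCombination]
      split_ifs with h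
      · rfl
      · exact (hQ k (by omega)).symm
    change Submodule.Quotient.mk (φ _) = _
    rw [this, Submodule.Quotient.eq, sub_sub_cancel_left]
    exact neg_mem (Ideal.mem_span_singleton'.2 ⟨Q, rfl⟩)
  let e := LinearEquiv.ofBijective ψ ⟨hinj, hsurj⟩
  exact ⟨Module.Finite.equiv e, by rw [← e.finrank_eq, Module.finrank_fin_fun]⟩

theorem finrank_quotient_inf {I J : Ideal (OrePoly σ δ)} (h : I ⊔ J = ⊤)
    [Module.Finite K (OrePoly σ δ ⧸ I)] [Module.Finite K (OrePoly σ δ ⧸ J)] :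
    Module.Finite K (OrePoly σ δ ⧸ I ⊓ J) ∧
      Module.finrank K (OrePoly σ δ ⧸ I ⊓ J) =
        Module.finrank K (OrePoly σ δ ⧸ I) + Module.finrank K (OrePoly σ δ ⧸ J) := by
  let f := (Submodule.mkQ I).prod (Submodule.mkQ J)
  have hker : LinearMap.ker f = I ⊓ J := by
    rw [LinearMap.ker_prod, Submodule.ker_mkQ, Submodule.ker_mkQ]
  have hsurj : Function.Surjective f := by
    rintro ⟨p, q⟩
    obtain ⟨F, rfl⟩ := Submodule.Quotient.mk_surjective _ p
    obtain ⟨G, rfl⟩ := Submodule.Quotient.mk_surjective _ q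
    obtain ⟨u, hu, v, hv, huv⟩ := Submodule.mem_sup.1 (h ▸ Submodule.mem_top : F - G ∈ I ⊔ J)
    have hFG : F - u = G + v := by rw [sub_eq_iff_eq_add, add_assoc, add_comm v, huv]; abel
    -- `F - u = G + v` is congruent to `F` modulo `I` and to `G` modulo `J`.
    refine ⟨F - u, Prod.ext ?_ ?_⟩
    · exact (Submodule.Quotient.eq I).2 (by simpa using hu)
    · exact (Submodule.Quotient.eq J).2 (by rw [hFG]; simpa using hv)
  let e := (Submodule.quotEquivOfEq _ _ hker.symm).trans (f.quotKerEquivOfSurjective hsurj)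
  let e' := e.restrictScalars K
  exact ⟨Module.Finite.equiv e'.symm, by rw [e'.finrank_eq, Module.finrank_prod]⟩

/-! ### Vectors of `R / m` killed by linear polynomials -/

/-- Take the last of `g, (x - a) g, (x - a) ^ 2 g, …` before the sequence first enters `m`. -/
theorem exists_linear_annihilator_of_pow {m : Ideal (OrePoly σ δ)} {a : K} {r : ℕ}
    {g : OrePoly σ δ} (hg : g ∉ m) (h : (X - C a) ^ r * g ∈ m) :
    ∃ h, h ∉ m ∧ (X - C a) * h ∈ m := by
  induction r with
  | zero => exact absurd (by simpa using h) hg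
  | succ r ih =>
    by_cases hr : (X - C a) ^ r * g ∈ m
    · exact ih hr
    · exact ⟨_, hr, by rwa [← mul_assoc, ← pow_succ']⟩

theorem exists_sub_mul_X_sub_C (f : OrePoly σ δ) (a : K) :
    ∃ (q : OrePoly σ δ) (c : K), f = q * (X - C a) + C c := by
  obtain ⟨q, hq⟩ := exists_sub_mul_degLT (d := 1) (degLT_X_sub_C a)
    (by rw [← pow_one (X - C a)]; exact (X_sub_C_pow a 1).2) f
  refine ⟨q, (f - q * (X - C a)).coeff 0, ?_⟩
  rw [← sub_eq_iff_eq_add']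
  ext k
  rw [coeff_C]
  split_ifs with h
  · rw [← h]
  · exact hq k (by omega)

/-- By simplicity `h ≡ f g` modulo `m`; since `x - a` kills `g`, only the remainder `c` of `f` acts,
so `h ≡ c g`, and this `c` is the conjugator. -/
theorem skewConj_of_linear_annihilators {m : Ideal (OrePoly σ δ)} (hm : m.IsMaximal) {a b : K}
    {g h : OrePoly σ δ} (hg : g ∉ m) (hag : (X - C a) * g ∈ m) (hh : h ∉ m)
    (hbh : (X - C b) * h ∈ m) : SkewConj σ δ a b := by
  obtain ⟨f, hf⟩ : ∃ f, h - f * g ∈ m := by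
    have htop : m ⊔ Ideal.span {g} = ⊤ :=
      hm.1.2 _ (lt_of_le_of_ne le_sup_left fun he => hg <|
        he ▸ (le_sup_right : Ideal.span {g} ≤ m ⊔ _) (Ideal.mem_span_singleton_self g))
    obtain ⟨u, hu, v, hv, huv⟩ := Submodule.mem_sup.1 (htop ▸ Submodule.mem_top : h ∈ m ⊔ _)
    obtain ⟨f, rfl⟩ := Ideal.mem_span_singleton'.1 hv
    exact ⟨f, by rwa [← huv, add_sub_cancel_right]⟩
  obtain ⟨q, c, rfl⟩ := exists_sub_mul_X_sub_C f a
  have hcg : h - C c * g ∈ m := by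
    have := m.add_mem hf (m.mul_mem_left q hag)
    convert this using 1
    noncomm_ring
  have hc : c ≠ 0 := by
    rintro rfl
    rw [map_zero, zero_mul, sub_zero] at hcg
    exact hh hcg
  refine ⟨c, hc, ?_⟩
  -- `(x - b) c = σ(c) (x - a) + (σ(c) a + δ(c) - b c)`, and both `(x - b) c` and `x - a` kill `g`
  -- modulo `m`.
  have hconst : C (σ c * a + δ c - b * c) * g ∈ m := by
    have h1 := m.sub_mem hbh (m.mul_mem_left (X - C b) hcg)
    have h2 := m.sub_mem h1 (m.mul_mem_left (C (σ c)) hag)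
    convert h2 using 1
    have hX := X_mul_C (σ := σ) (δ := δ) c
    have : (X - C b) * h - (X - C b) * (h - C c * g) - C (σ c) * ((X - C a) * g) =
        (X * C c - C b * C c - C (σ c) * X + C (σ c) * C a) * g := by noncomm_ring
    rw [this, hX, map_sub, map_add, map_mul, map_mul]
    congr 1
    abel
  have hzero : σ c * a + δ c - b * c = 0 := by
    by_contra hne
    refine hg ?_
    have := m.mul_mem_left (C (σ c * a + δ c - b * c)⁻¹) hconst
    rwa [← mul_assoc, ← map_mul, inv_mul_cancel₀ hne, map_one, one_mul] at this
  rw [← add_mul, eq_mul_inv_iff_mul_eq₀ hc]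
  exact (sub_eq_zero.1 hzero).symm

/-- In the simple module `R / m`, an element killed by `I ⊓ J` with `I`, `J` comaximal yields one
killed by `I` or by `J`. -/
theorem exists_annihilated_of_inf {m I J : Ideal (OrePoly σ δ)} (h : I ⊔ J = ⊤)
    {g : OrePoly σ δ} (hg : g ∉ m) (hIJ : ∀ f ∈ I ⊓ J, f * g ∈ m) :
    (∃ g', g' ∉ m ∧ ∀ f ∈ I, f * g' ∈ m) ∨ ∃ g', g' ∉ m ∧ ∀ f ∈ J, f * g' ∈ m := by
  obtain ⟨e, he, e', he', hee⟩ := Submodule.mem_sup.1 (h ▸ Submodule.mem_top : 1 ∈ I ⊔ J)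
  by_cases hge : e * g ∈ m
  -- For `f ∈ I`, `f e' = f - f e` lies in both `I` and `J`, so `I` kills `e' g`.
  · refine Or.inl ⟨e' * g, fun hge' => hg ?_, fun f hf => ?_⟩
    · simpa [← add_mul, hee] using m.add_mem hge hge'
    · rw [← mul_assoc]
      refine hIJ _ ⟨?_, J.mul_mem_left f he'⟩
      rw [← eq_sub_iff_add_eq'] at hee
      rw [hee, mul_sub, mul_one]
      exact I.sub_mem hf (I.mul_mem_left f he)
  · refine Or.inr ⟨e * g, hge, fun f hf => ?_⟩
    rw [← mul_assoc]
    refine hIJ _ ⟨I.mul_mem_left f he, ?_⟩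
    rw [← eq_sub_iff_add_eq] at hee
    rw [hee, mul_sub, mul_one]
    exact J.sub_mem hf (J.mul_mem_left f he')

/-! ### Comaximality and the dimension count -/

/-- The last clause is carried through the induction because it yields the comaximality needed to
add the next factor. -/
theorem finrank_quotient_finset_inf {ι : Type*} (a : ι → K) (r : ι → ℕ)
    (ha : ∀ i j, i ≠ j → ¬ SkewConj σ δ (a i) (a j)) (s : Finset ι) :
    Module.Finite K (OrePoly σ δ ⧸ s.inf fun i => Ideal.span {((X - C (a i)) ^ r i : OrePoly σ δ)}) ∧
    Module.finrank K
        (OrePoly σ δ ⧸ s.inf fun i => Ideal.span {((X - C (a i)) ^ r i : OrePoly σ δ)}) =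
      ∑ i ∈ s, r i ∧
    ∀ m : Ideal (OrePoly σ δ), m.IsMaximal → ∀ g ∉ m,
      (∀ f ∈ s.inf fun i => Ideal.span {((X - C (a i)) ^ r i : OrePoly σ δ)}, f * g ∈ m) →
      ∃ i ∈ s, ∃ h, h ∉ m ∧ (X - C (a i)) * h ∈ m := by
  classical
  induction s using Finset.induction_on with
  | empty =>
    have : Subsingleton (OrePoly σ δ ⧸ (⊤ : Ideal (OrePoly σ δ))) :=
      Submodule.Quotient.subsingleton_iff.2 rfl
    rw [Finset.inf_empty]
    refine ⟨inferInstance, by rw [Finset.sum_empty]; exact Module.finrank_zero_of_subsingleton,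
      fun m _ g hg h => absurd (by simpa using h 1 trivial) hg⟩
  | insert i s hi ih =>
    obtain ⟨hfin, hrank, hann⟩ := ih
    rw [Finset.inf_insert, Finset.sum_insert hi]
    generalize (s.inf fun i => Ideal.span {((X - C (a i)) ^ r i : OrePoly σ δ)}) = J at *
    obtain ⟨hpow, hlead⟩ := X_sub_C_pow (σ := σ) (δ := δ) (a i) (r i)
    obtain ⟨hfin', hrank'⟩ := finrank_quotient_span hpow hlead
    have hann' : ∀ m : Ideal (OrePoly σ δ), ∀ g ∉ m,
        (∀ f ∈ Ideal.span {(X - C (a i)) ^ r i}, f * g ∈ m) →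
        ∃ h, h ∉ m ∧ (X - C (a i)) * h ∈ m := fun m g hg h =>
      exists_linear_annihilator_of_pow hg (h _ (Ideal.mem_span_singleton_self _))
    have htop : Ideal.span {(X - C (a i)) ^ r i} ⊔ J = ⊤ := by
      by_contra hne
      obtain ⟨m, hm, hle⟩ := Ideal.exists_le_maximal _ hne
      have h1 : (1 : OrePoly σ δ) ∉ m := (Ideal.ne_top_iff_one m).1 hm.ne_top
      obtain ⟨j, hj, h, hh, hjh⟩ := hann m hm 1 h1 fun f hf => by
        rw [mul_one]; exact hle (Submodule.mem_sup_right hf)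
      obtain ⟨h', hh', hih⟩ := hann' m 1 h1 fun f hf => by
        rw [mul_one]; exact hle (Submodule.mem_sup_left hf)
      exact ha i j (fun he => hi (he ▸ hj)) (skewConj_of_linear_annihilators hm hh' hih hh hjh)
    obtain ⟨hfin'', hrank''⟩ := finrank_quotient_inf htop
    refine ⟨hfin'', by rw [hrank'', hrank', hrank], fun m hm g hg h => ?_⟩
    rcases exists_annihilated_of_inf htop hg h with ⟨g', hg', h'⟩ | ⟨g', hg', h'⟩
    · exact ⟨i, Finset.mem_insert_self i s, hann' m g' hg' h'⟩
    · obtain ⟨j, hj, hj'⟩ := hann m hm g' hg' h'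
      exact ⟨j, Finset.mem_insert_of_mem hj, hj'⟩

/-! ### Least left common multiples and the conclusion -/

theorem isLCLM_iff {ι : Type*} [Fintype ι] (P : ι → OrePoly σ δ) (M : OrePoly σ δ) :
    IsLCLM P M ↔ M.Monic ∧ Finset.univ.inf (fun i => Ideal.span {P i}) = Ideal.span {M} := by
  have hmem : ∀ G, G ∈ Finset.univ.inf (fun i => Ideal.span {P i}) ↔ ∀ i, RightDvd (P i) G := by
    simp [Submodule.mem_finsetInf, rightDvd_iff]
  rw [IsLCLM]
  refine and_congr_right fun _ => ⟨fun ⟨h, h'⟩ => le_antisymm (fun G hG => ?_) ?_, fun h => ?_⟩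
  · exact rightDvd_iff.1 (h' G ((hmem G).1 hG))
  · exact (Ideal.span_singleton_le_iff_mem _).2 ((hmem M).2 h)
  · exact ⟨(hmem M).1 (h ▸ Ideal.mem_span_singleton_self M),
      fun G hG => rightDvd_iff.2 (h ▸ (hmem G).2 hG)⟩

theorem Monic.eq_of_span_eq {M N : OrePoly σ δ} (hM : M.Monic) (hN : N.Monic)
    (h : Ideal.span {M} = Ideal.span {N}) : M = N := by
  obtain ⟨d, hMd, hM1⟩ := monic_iff.1 hM
  obtain ⟨e, hNe, hN1⟩ := monic_iff.1 hN
  -- Both degrees are the dimension of the same quotient.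
  have hde : d = e := by
    rw [← (finrank_quotient_span hMd hM1).2, h, (finrank_quotient_span hNe hN1).2]
  subst hde
  obtain ⟨G, hG⟩ := Ideal.mem_span_singleton'.1 (h ▸ Ideal.mem_span_singleton_self M)
  have hlt : (M - N).DegLT d := fun k hk => by
    rcases hk.eq_or_lt with rfl | hk
    · rw [coeff_sub, hM1, hN1, sub_self]
    · rw [coeff_sub, hMd k hk, hNe k hk, sub_self]
  have hG1 : G - 1 = 0 := eq_zero_of_degLT_of_eq_mul hNe hN1 (by rwa [sub_mul, one_mul, hG])
  rw [← hG, sub_eq_zero.1 hG1, one_mul]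

end

end OrePoly

open OrePoly in
theorem mainTheorem10 {K : Type*} [DivisionRing K] (σ : K →+* K) (δ : SkewDerivation σ)
    (n : ℕ) (a : Fin n → K) (r : Fin n → ℕ) (hr : ∀ i, 0 < r i)
    (ha : ∀ i j, i ≠ j → ¬ SkewConj σ δ (a i) (a j))
    (F : OrePoly σ δ) (hF : F ≠ 0) (hz : ∀ i, F.IsZeroOfMult (a i) (r i)) :
    (((∑ i, r i : ℕ) : WithBot ℕ) ≤ F.degree) ∧
    (∃! M : OrePoly σ δ, OrePoly.IsLCLM (fun i => (OrePoly.X - OrePoly.C (a i)) ^ r i) M) ∧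
    (∀ M : OrePoly σ δ, OrePoly.IsLCLM (fun i => (OrePoly.X - OrePoly.C (a i)) ^ r i) M →
      (((∑ i, r i : ℕ) : WithBot ℕ) = F.degree ↔ ∃ c : K, c ≠ 0 ∧ F = OrePoly.C c * M)) := by
  have hFJ : F ∈ Finset.univ.inf fun i => Ideal.span {((X - C (a i)) ^ r i : OrePoly σ δ)} := by
    rw [Submodule.mem_finsetInf]
    exact fun i _ => rightDvd_iff.1 (hz i)
  -- `F` itself witnesses that the intersection is nonzero.
  obtain ⟨M, hM, hJ⟩ := exists_span_singleton hFJ hF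
  have hML := (isLCLM_iff _ M).2 ⟨hM, hJ⟩
  have huniq : ∀ N, IsLCLM (fun i => ((X - C (a i)) ^ r i : OrePoly σ δ)) N → N = M := fun N hN =>
    ((isLCLM_iff _ N).1 hN).1.eq_of_span_eq hM (((isLCLM_iff _ N).1 hN).2.symm.trans hJ)
  obtain ⟨d, hMd, hM1⟩ := monic_iff.1 hM
  have hd : ∑ i, r i = d := by
    rw [← (finrank_quotient_finset_inf a r ha Finset.univ).2.1, hJ, (finrank_quotient_span hMd hM1).2]
  have hMdeg : M.degree = d := degree_eq_iff.2 ⟨hMd, by simp [hM1]⟩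
  obtain ⟨G, hG⟩ := Ideal.mem_span_singleton'.1 (hJ ▸ hFJ)
  have hG0 : G ≠ 0 := by
    rintro rfl
    exact hF (by rw [← hG, zero_mul])
  obtain ⟨e, he⟩ := exists_degree_eq hG0
  have hFdeg : F.degree = (e + d : ℕ) := by rw [← hG]; exact degree_mul he hMdeg
  rw [hd, hFdeg]
  refine ⟨by exact_mod_cast Nat.le_add_left d e, ⟨M, hML, huniq⟩, fun N hN => ?_⟩
  obtain rfl := huniq N hN
  constructor
  · intro h
    -- Equality of degrees forces the cofactor `G` in `F = G M` to be constant.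
    have he0 : e = 0 := by
      have : d = e + d := by exact_mod_cast h
      omega
    subst he0
    rw [degree_eq_iff] at he
    refine ⟨G.coeff 0, he.2, ?_⟩
    rw [← hG]
    congr 1
    ext k
    rw [coeff_C]
    split_ifs with hk
    · rw [hk]
    · exact he.1 k (by omega)
  · rintro ⟨c, hc, h⟩
    rw [← hFdeg, h, ← zero_add d]
    refine (degree_mul (degree_eq_iff.2 ⟨fun k hk => ?_, ?_⟩) hMdeg).symm
    · rw [coeff_C, if_neg (by omega)]
    · rwa [coeff_C, if_pos rfl]
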